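/- A \emph{recursive tree} on $n$ vertices is a tree with vertex set $\{0,1,\dots,n-1\}$, rooted at $0$, such that the labels strictly increase along every path starting at $0$. Its \emph{smallest rooted path} is the path that starts at $0$, always goes to the child with the smallest label, and stops at a vertex without children. Let $R(n,\ell,i)$ be the number of recursive trees on $n$ vertices that have exactly $\ell$ vertices of degree $1$ (the root being counted if its degree is $1$) and whose smallest rooted path ends at $i$. Let $A(n,m,k)$ be the number of permutations $\sigma$ of $\{1,\dots,n\}$ with exactly $m$ descents (positions $j<n$ with $\sigma(j)>\sigma(j+1)$) and $\sigma(n)=k$. **Theorem.** Let $n\ge 3$, $\ell \ge 0$ and $2\le i\le n-1$ be integers. Then $R(n,\ell,i)$ is equal to the number of permutations of $\{1,\dots,n-1\}$ that end with $i-1$ and have exactly $\ell-1$ descents; that is, $$R(n,\ell,i)=A(n-1,\ell-1,i-1).$$ -/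

import Mathlib

/-- A recursive tree on the vertices `0, …, n - 1`, rooted at `0`: a tree such that the labels
strictly increase along every path starting at `0`.
(There is no such tree for `n = 0`, as a tree is nonempty.) -/
def IsRecursiveTree {n : ℕ} (G : SimpleGraph (Fin n)) : Prop :=
  G.IsTree ∧ ∀ (r v : Fin n) (p : G.Walk r v), r.val = 0 → p.IsPath → p.support.SortedLT

/-- `w` is a child of `v`. In a recursive tree the children of `v` are its neighbours with a larger
label, the only neighbour with a smaller label being the parent of `v`. -/
def IsChild {n : ℕ} (G : SimpleGraph (Fin n)) (v w : Fin n) : Prop :=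
  G.Adj v w ∧ v < w

/-- `w` is the smallest child of `v`. -/
def IsSmallestChild {n : ℕ} (G : SimpleGraph (Fin n)) (v w : Fin n) : Prop :=
  IsLeast {u | IsChild G v u} w

/-- The smallest rooted path, which starts at `0` and always goes to the smallest child for as long
as there is one, ends at the vertex `x`. -/
def SmallestRootedPathEndsAt {n : ℕ} (G : SimpleGraph (Fin n)) (x : Fin n) : Prop :=
  ∃ r : Fin n, r.val = 0 ∧ Relation.ReflTransGen (IsSmallestChild G) r x ∧ ∀ w, ¬ IsChild G x w

open Classical in
/-- The number of vertices of degree `1` (the root included if it has degree `1`). -/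
noncomputable def numDegreeOne {n : ℕ} (G : SimpleGraph (Fin n)) : ℕ :=
  (Finset.univ.filter fun v : Fin n => G.degree v = 1).card

/-- `R(n, ℓ, x)`: the number of recursive trees on `n` vertices with `ℓ` vertices of degree `1`
whose smallest rooted path ends at `x`. -/
noncomputable def recursiveTreeNumber (n ℓ x : ℕ) : ℕ :=
  Nat.card {G : SimpleGraph (Fin n) // IsRecursiveTree G ∧ numDegreeOne G = ℓ ∧
    ∃ v : Fin n, v.val = x ∧ SmallestRootedPathEndsAt G v}

/-- The number of descents of a permutation of `n` letters: positions `j`, other than the last one,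
with `σ (j + 1) < σ j`. -/
def numDescents {n : ℕ} (σ : Equiv.Perm (Fin n)) : ℕ :=
  (Finset.univ.filter fun j : Fin n => ∃ h : j.val + 1 < n, σ ⟨j.val + 1, h⟩ < σ j).card

/-- The last letter of `σ` is `k`, where the letters `Fin n = {0, …, n - 1}` are read as
`1, …, n`. -/
def EndsWith {n : ℕ} (σ : Equiv.Perm (Fin n)) (k : ℤ) : Prop :=
  ∃ j : Fin n, j.val + 1 = n ∧ ((σ j).val : ℤ) + 1 = k

/-- `A(n, m, k)`: the number of permutations of `{1, …, n}` with `m` descents that end with `k`. -/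
noncomputable def eulerianEnding (n : ℕ) (m k : ℤ) : ℕ :=
  Nat.card {σ : Equiv.Perm (Fin n) // (numDescents σ : ℤ) = m ∧ EndsWith σ k}

/-! Both sides satisfy the same recursion in the size. Put `m = ℓ - 1` and `k = i - 2`. Every
recursive tree arises uniquely by hanging successive largest vertices on existing ones. On at least
two vertices, hanging on `u` keeps the number of vertices of degree one if `u` has degree one and
raises it by one otherwise. The end of the smallest rooted path has degree one, and it moves (to the
new vertex) only if `u` is that end. So `m` of the `m + 1` vertices of degree one preserve both
statistics, which gives `treeEndCount_succ`; its coefficients are those of `eulerLast_rec` for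
permutations with a fixed last letter.

The recursion starts where the path ends at the largest vertex. Deleting that vertex leaves an
arbitrary tree (`treeEndCount_last`), so all trees must be counted by permutations ending with the
second largest letter. This is a second comparison of recursions, between `treeCount_succ` and
`eulerLast_penultimate_rec`. -/

/-! ### Permutations by descents and last letter -/

/-- The permutation of `{0, …, N}` that ends with `k` and whose other letters are in the same
relative order as those of `τ`. -/
noncomputable def appendLetter {N : ℕ} (k : Fin (N + 1)) (τ : Equiv.Perm (Fin N)) :
    Equiv.Perm (Fin (N + 1)) :=
  Equiv.ofBijective (Fin.lastCases k fun j => k.succAbove (τ j)) <| by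
    rw [← Finite.injective_iff_bijective]
    intro x y
    induction x using Fin.lastCases <;> induction y using Fin.lastCases <;>
      simp [Fin.succAbove_ne, (Fin.succAbove_ne _ _).symm]

@[simp] theorem appendLetter_last {N : ℕ} (k : Fin (N + 1)) (τ : Equiv.Perm (Fin N)) :
    appendLetter k τ (Fin.last N) = k := by
  simp [appendLetter]

@[simp] theorem appendLetter_castSucc {N : ℕ} (k : Fin (N + 1)) (τ : Equiv.Perm (Fin N))
    (j : Fin N) : appendLetter k τ j.castSucc = k.succAbove (τ j) := by
  simp [appendLetter]

theorem appendLetter_bijective (N : ℕ) :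
    Function.Bijective fun x : Fin (N + 1) × Equiv.Perm (Fin N) => appendLetter x.1 x.2 := by
  rw [Fintype.bijective_iff_injective_and_card]
  constructor
  · rintro ⟨k, τ⟩ ⟨k', τ'⟩ h
    have hk : k = k' := by simpa using congrArg (fun σ => σ (Fin.last N)) h
    subst hk
    have : τ = τ' := by
      ext j : 1
      simpa using congrArg (fun σ => σ j.castSucc) h
    rw [this]
  · simp [Fintype.card_perm, Nat.factorial_succ]

theorem numDescents_eq_sum {N : ℕ} (σ : Equiv.Perm (Fin (N + 1))) :
    numDescents σ = ∑ j : Fin N, if σ j.succ < σ j.castSucc then 1 else 0 := by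
  classical
  unfold numDescents
  rw [Finset.card_filter, Fin.sum_univ_castSucc]
  have h : ¬ ∃ h : (Fin.last N).val + 1 < N + 1, σ ⟨(Fin.last N).val + 1, h⟩ < σ (Fin.last N) := by
    rintro ⟨h, -⟩
    simp at h
  rw [if_neg h, add_zero]
  refine Finset.sum_congr rfl fun j _ => if_congr ⟨fun ⟨_, h⟩ => h, fun h => ⟨by simp, h⟩⟩ rfl rfl

theorem numDescents_appendLetter {N : ℕ} (k : Fin (N + 2)) (τ : Equiv.Perm (Fin (N + 1))) :
    numDescents (appendLetter k τ) =
      numDescents τ + if k.val ≤ (τ (Fin.last N)).val then 1 else 0 := by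
  rw [numDescents_eq_sum, numDescents_eq_sum, Fin.sum_univ_castSucc]
  congr 1
  · refine Finset.sum_congr rfl fun j _ => if_congr ?_ rfl rfl
    rw [Fin.succ_castSucc, appendLetter_castSucc, appendLetter_castSucc,
      Fin.succAbove_lt_succAbove_iff]
  · refine if_congr ?_ rfl rfl
    rw [Fin.succ_last, appendLetter_last, appendLetter_castSucc, Fin.lt_succAbove_iff_le_castSucc]
    rfl

/-- The number of permutations of `{0, …, N}` with `m` descents that end with `k`. -/
noncomputable def eulerLast (N : ℕ) (m : ℤ) (k : ℕ) : ℤ :=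
  ∑ σ : Equiv.Perm (Fin (N + 1)),
    if (numDescents σ : ℤ) = m ∧ (σ (Fin.last N)).val = k then 1 else 0

/-- The number of permutations of `{0, …, N}` with `m` descents. -/
noncomputable def euler (N : ℕ) (m : ℤ) : ℤ :=
  ∑ σ : Equiv.Perm (Fin (N + 1)), if (numDescents σ : ℤ) = m then 1 else 0

theorem euler_eq_sum (N : ℕ) (m : ℤ) :
    euler N m = ∑ k ∈ Finset.range (N + 1), eulerLast N m k := by
  unfold euler eulerLast
  rw [Finset.sum_comm]
  refine Finset.sum_congr rfl fun σ _ => ?_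
  by_cases h : (numDescents σ : ℤ) = m <;> simp [h, Fin.is_le]

theorem eulerianEnding_eq (N : ℕ) (m : ℤ) (k : ℕ) :
    (eulerianEnding (N + 1) m (k + 1) : ℤ) = eulerLast N m k := by
  classical
  unfold eulerianEnding eulerLast
  rw [Nat.card_eq_fintype_card, Fintype.card_subtype, Finset.card_filter]
  push_cast
  refine Finset.sum_congr rfl fun σ _ => if_congr (and_congr_right fun _ => ?_) rfl rfl
  constructor
  · rintro ⟨j, hj, h⟩
    obtain rfl : j = Fin.last N := Fin.ext (by simpa using hj)
    omega
  · rintro h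
    exact ⟨Fin.last N, rfl, by omega⟩

theorem eulerLast_succ (N : ℕ) (m : ℤ) {k : ℕ} (hk : k ≤ N + 1) :
    eulerLast (N + 1) m k = ∑ τ : Equiv.Perm (Fin (N + 1)),
      if (numDescents τ : ℤ) + (if k ≤ (τ (Fin.last N)).val then 1 else 0) = m then 1 else 0 := by
  unfold eulerLast
  rw [← (appendLetter_bijective (N + 1)).sum_comp, Fintype.sum_prod_type,
    Finset.sum_eq_single (⟨k, by omega⟩ : Fin (N + 2))]
  · simp [numDescents_appendLetter]
  · intro b _ hb
    refine Finset.sum_eq_zero fun τ _ => if_neg ?_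
    rintro ⟨-, h⟩
    exact hb (Fin.ext (by simpa using h))
  · simp

theorem eulerLast_succ_zero (N : ℕ) (m : ℤ) : eulerLast (N + 1) m 0 = euler N (m - 1) := by
  rw [eulerLast_succ N m (Nat.zero_le _), euler]
  refine Finset.sum_congr rfl fun τ _ => if_congr ?_ rfl rfl
  simp only [Nat.zero_le, if_true]
  omega

theorem eulerLast_succ_last (N : ℕ) (m : ℤ) : eulerLast (N + 1) m (N + 1) = euler N m := by
  rw [eulerLast_succ N m le_rfl, euler]
  refine Finset.sum_congr rfl fun τ _ => if_congr ?_ rfl rfl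
  rw [if_neg (by omega), add_zero]

/-- Raising the final letter from `k` to `k + 1` affects only those `τ` that end with `k`: their
last descent disappears. -/
theorem eulerLast_succ_succ (N : ℕ) (m : ℤ) {k : ℕ} (hk : k ≤ N) :
    eulerLast (N + 1) m (k + 1) =
      eulerLast (N + 1) m k + eulerLast N m k - eulerLast N (m - 1) k := by
  rw [eulerLast_succ N m (by omega : k + 1 ≤ N + 1), eulerLast_succ N m (by omega : k ≤ N + 1),
    eulerLast, eulerLast, ← Finset.sum_add_distrib, ← Finset.sum_sub_distrib]
  refine Finset.sum_congr rfl fun τ _ => ?_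
  split_ifs <;> omega

theorem eulerLast_zero_zero (m : ℤ) : eulerLast 0 m 0 = if m = 0 then 1 else 0 := by
  simp [eulerLast, numDescents_eq_sum, eq_comm]

theorem euler_zero (m : ℤ) : euler 0 m = if m = 0 then 1 else 0 := by
  rw [euler_eq_sum, Finset.sum_range_one, eulerLast_zero_zero]

/-- The Eulerian recursion, by summing `h` over `k`. The coefficient is `m + 1` instead of `m`
because permutations ending with their largest letter contribute a further `euler N m`. -/
theorem euler_succ_of {N : ℕ} (h : ∀ (m : ℤ), ∀ k ≤ N, eulerLast (N + 1) m k =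
      m * eulerLast N m k + (N + 2 - m) * eulerLast N (m - 1) k) (m : ℤ) :
    euler (N + 1) m = (m + 1) * euler N m + (N + 2 - m) * euler N (m - 1) := by
  rw [euler_eq_sum, Finset.sum_range_succ, eulerLast_succ_last,
    Finset.sum_congr rfl fun k hk => h m k (by simpa [Nat.lt_succ_iff] using hk),
    Finset.sum_add_distrib, ← Finset.mul_sum, ← Finset.mul_sum, ← euler_eq_sum, ← euler_eq_sum]
  ring

/-- The effect of inserting the largest letter anywhere but at the end. -/
theorem eulerLast_rec (N : ℕ) : ∀ (m : ℤ), ∀ k ≤ N, eulerLast (N + 1) m k =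
    m * eulerLast N m k + (N + 2 - m) * eulerLast N (m - 1) k := by
  induction N with
  | zero =>
    intro m k hk
    obtain rfl : k = 0 := by omega
    rw [eulerLast_succ_zero, euler_zero, eulerLast_zero_zero, eulerLast_zero_zero]
    split_ifs <;> push_cast <;> omega
  | succ N ih =>
    intro m k
    induction k with
    | zero =>
      intro _
      rw [eulerLast_succ_zero, euler_succ_of ih, eulerLast_succ_zero, eulerLast_succ_zero]
      push_cast
      ring
    | succ k ihk =>
      intro hk
      -- All terms reduce to size `N` and last letter `k`, where the identity is polynomial.
      rw [eulerLast_succ_succ _ _ (by omega), ihk (by omega),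
        eulerLast_succ_succ N _ (by omega), eulerLast_succ_succ N _ (by omega),
        ih m k (by omega), ih (m - 1) k (by omega)]
      push_cast
      ring

/-- Every term is a combination of the values of `eulerLast N` at last letter `N`, so comparing
coefficients suffices. -/
theorem eulerLast_penultimate_rec (N : ℕ) (m : ℤ) : eulerLast (N + 2) m (N + 1) =
    (m + 1) * eulerLast (N + 1) m N + (N + 2 - m) * eulerLast (N + 1) (m - 1) N := by
  rw [eulerLast_rec (N + 1) m (N + 1) le_rfl, eulerLast_succ_succ N m le_rfl,
    eulerLast_succ_succ N (m - 1) le_rfl, eulerLast_rec N m N le_rfl,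
    eulerLast_rec N (m - 1) N le_rfl]
  push_cast
  ring

/-! ### Recursive trees as graphs with unique smaller neighbours -/

theorem walk_le_of_mem_support {V : Type*} [LinearOrder V] {G : SimpleGraph V} {u v w : V}
    {p : G.Walk u v} (hp : p.support.SortedLT) (hw : w ∈ p.support) : w ≤ v := by
  have h := hp.pairwise
  rw [← p.dropLast_support_concat] at h hw
  rw [List.pairwise_append] at h
  rcases List.mem_append.1 hw with hw | hw
  · exact (h.2.2 w hw v (by simp)).le
  · exact (List.mem_singleton.1 hw).le

/-- The parent is the penultimate vertex of the path from `0`. For a smaller neighbour `w`, the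
increasing path to `w` avoids `v`, so acyclicity forces `w` to be that vertex. -/
theorem IsRecursiveTree.existsUnique_lt {N : ℕ} {G : SimpleGraph (Fin (N + 1))}
    (hG : IsRecursiveTree G) {v : Fin (N + 1)} (hv : v ≠ 0) : ∃! u, G.Adj u v ∧ u < v := by
  obtain ⟨hT, hs⟩ := hG
  obtain ⟨p, hp, -⟩ := hT.existsUnique_path 0 v
  have hnil : ¬ p.Nil := fun h => hv h.eq.symm
  have hadj := p.adj_penultimate hnil
  refine ⟨p.penultimate, ⟨hadj, lt_of_le_of_ne
    (walk_le_of_mem_support (hs 0 v p rfl hp) (p.getVert_mem_support _)) hadj.ne⟩, ?_⟩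
  rintro w ⟨hwv, hlt⟩
  obtain ⟨q, hq, -⟩ := hT.existsUnique_path 0 w
  refine hT.isAcyclic.eq_penultimate_of_adj_end hp hwv.symm
    (hT.isAcyclic.mem_support_of_ne_mem_support_of_adj_of_isPath hp hq hwv.symm fun hmem => ?_)
  exact hlt.not_ge (walk_le_of_mem_support (hs 0 w q rfl hq) hmem)

theorem sortedLT_support_of_existsUnique_lt {N : ℕ} {G : SimpleGraph (Fin (N + 1))}
    (h : ∀ v ≠ 0, ∃! u, G.Adj u v ∧ u < v) {r v : Fin (N + 1)} (p : G.Walk r v) (hr : r = 0)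
    (hp : p.IsPath) : p.support.SortedLT := by
  induction p using SimpleGraph.Walk.concatRec with
  | Hnil => simp [List.sortedLT_iff_pairwise]
  | @Hconcat u v w q hvw ih =>
    rw [SimpleGraph.Walk.concat_isPath_iff] at hp
    have hq := ih hr hp.1
    -- A descending last step would return to the unique smaller neighbour of `v`, which `q` has
    -- already visited.
    have hlt : v < w := by
      by_contra hle
      have hwv : w < v := lt_of_le_of_ne (not_lt.1 hle) hvw.ne'
      have hv : v ≠ 0 := (lt_of_le_of_lt (Fin.zero_le w) hwv).ne'
      have hnil : ¬ q.Nil := fun hn => hv (hn.eq.symm.trans hr)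
      have hadj := q.adj_penultimate hnil
      have hmem := q.getVert_mem_support (q.length - 1)
      have := (h v hv).unique ⟨hvw.symm, hwv⟩
        ⟨hadj, lt_of_le_of_ne (walk_le_of_mem_support hq hmem) hadj.ne⟩
      exact hp.2 (this ▸ hmem)
    rw [SimpleGraph.Walk.support_concat, List.sortedLT_iff_pairwise, List.pairwise_append]
    refine ⟨hq.pairwise, by simp, fun a ha b hb => ?_⟩
    rw [List.mem_singleton.1 hb]
    exact (walk_le_of_mem_support hq ha).trans_lt hlt

/-- The largest vertex of a cycle would have two distinct smaller neighbours. -/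
theorem isAcyclic_of_unique_lt {V : Type*} [LinearOrder V] {G : SimpleGraph V}
    (h : ∀ u v w, G.Adj u w → u < w → G.Adj v w → v < w → u = v) : G.IsAcyclic := by
  intro v c hc
  have hne : c.support.toFinset.Nonempty := ⟨v, by simp⟩
  set m := c.support.toFinset.max' hne with hm
  have hmem : m ∈ c.support := by simpa using Finset.max'_mem _ hne
  have hle : ∀ x ∈ c.support, x ≤ m := fun x hx => Finset.le_max' _ _ (by simpa using hx)
  have hd := hc.rotate hmem
  have hsub : ∀ x ∈ (c.rotate m hmem).support, x ≤ m := fun x hx =>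
    hle x ((SimpleGraph.Walk.mem_support_rotate_iff ..).1 hx)
  have h1 := (c.rotate m hmem).adj_snd hd.not_nil
  have h2 := (c.rotate m hmem).adj_penultimate hd.not_nil
  exact hd.snd_ne_penultimate (h _ _ m h1.symm
    (lt_of_le_of_ne (hsub _ (SimpleGraph.Walk.getVert_mem_support ..)) h1.ne') h2
    (lt_of_le_of_ne (hsub _ (SimpleGraph.Walk.getVert_mem_support ..)) h2.ne))

theorem isRecursiveTree_iff {N : ℕ} {G : SimpleGraph (Fin (N + 1))} :
    IsRecursiveTree G ↔ ∀ v ≠ 0, ∃! u, G.Adj u v ∧ u < v := by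
  refine ⟨fun hG v hv => hG.existsUnique_lt hv, fun h => ⟨⟨?_, ?_⟩, fun r v p hr hp =>
    sortedLT_support_of_existsUnique_lt h p (Fin.ext hr) hp⟩⟩
  · refine SimpleGraph.connected_iff_exists_forall_reachable G |>.2 ⟨0, fun v => ?_⟩
    induction v using WellFoundedLT.induction with
    | ind v ih =>
      by_cases hv : v = 0
      · rw [hv]
      · obtain ⟨u, ⟨hu, hlt⟩, -⟩ := h v hv
        exact (ih u hlt).trans hu.reachable
  · refine isAcyclic_of_unique_lt fun u v w hu hlt hv hlt' => ?_
    exact (h w (lt_of_le_of_lt (Fin.zero_le u) hlt).ne').unique ⟨hu, hlt⟩ ⟨hv, hlt'⟩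

/-- The largest vertex is nobody's smaller neighbour, so deleting it leaves the condition at the
other vertices intact. -/
theorem isRecursiveTree_succ_iff {N : ℕ} {H : SimpleGraph (Fin (N + 2))} :
    IsRecursiveTree H ↔
      IsRecursiveTree (H.comap Fin.castSucc) ∧ ∃! u : Fin (N + 1), H.Adj u.castSucc (Fin.last _) := by
  have key : ∀ v : Fin (N + 1), (∃! w, H.Adj w v.castSucc ∧ w < v.castSucc) ↔
      ∃! w, (H.comap Fin.castSucc).Adj w v ∧ w < v := by
    intro v
    constructor
    · rintro ⟨w, ⟨hw, hlt⟩, hu⟩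
      induction w using Fin.lastCases with
      | last => exact absurd hlt (Fin.le_last _).not_gt
      | cast w =>
        exact ⟨w, ⟨hw, by simpa using hlt⟩, fun y hy =>
          Fin.castSucc_injective _ (hu y.castSucc ⟨hy.1, by simpa using hy.2⟩)⟩
    · rintro ⟨w, ⟨hw, hlt⟩, hu⟩
      refine ⟨w.castSucc, ⟨hw, by simpa using hlt⟩, ?_⟩
      rintro y ⟨hy, hylt⟩
      induction y using Fin.lastCases with
      | last => exact absurd hylt (Fin.le_last _).not_gt
      | cast y => rw [hu y ⟨hy, by simpa using hylt⟩]
  have key' : (∃! w, H.Adj w (Fin.last (N + 1)) ∧ w < Fin.last (N + 1)) ↔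
      ∃! u : Fin (N + 1), H.Adj u.castSucc (Fin.last _) := by
    constructor
    · rintro ⟨w, ⟨hw, hlt⟩, hu⟩
      induction w using Fin.lastCases with
      | last => exact absurd hlt (lt_irrefl _)
      | cast w =>
        exact ⟨w, hw, fun y hy => Fin.castSucc_injective _ (hu _ ⟨hy, Fin.castSucc_lt_last y⟩)⟩
    · rintro ⟨w, hw, hu⟩
      refine ⟨w.castSucc, ⟨hw, Fin.castSucc_lt_last w⟩, ?_⟩
      rintro y ⟨hy, hlt⟩
      induction y using Fin.lastCases with
      | last => exact absurd hlt (lt_irrefl _)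
      | cast y => rw [hu y hy]
  rw [isRecursiveTree_iff, isRecursiveTree_iff, ← key']
  constructor
  · refine fun h => ⟨fun v hv => (key v).1 (h _ fun h0 => hv ?_), h _ (Fin.last_pos).ne'⟩
    exact Fin.castSucc_injective _ (h0.trans Fin.castSucc_zero.symm)
  · rintro ⟨h, hl⟩ v hv
    induction v using Fin.lastCases with
    | last => exact hl
    | cast v => exact (key v).2 (h v fun h0 => hv (by rw [h0, Fin.castSucc_zero]))

/-! ### Growing a tree by a largest leaf -/

/-- The graph `G` with a new largest vertex attached to the vertex `u`. -/
def attachLeaf {n : ℕ} (G : SimpleGraph (Fin n)) (u : Fin n) : SimpleGraph (Fin (n + 1)) :=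
  G.map Fin.castSucc ⊔ SimpleGraph.edge u.castSucc (Fin.last n)

section attachLeaf

variable {n : ℕ} (G : SimpleGraph (Fin n)) (u : Fin n)

@[simp] theorem attachLeaf_adj_castSucc_castSucc {v w : Fin n} :
    (attachLeaf G u).Adj v.castSucc w.castSucc ↔ G.Adj v w := by
  have hl : ∀ x : Fin n, x.castSucc ≠ Fin.last n := fun x => (Fin.castSucc_lt_last x).ne
  simp only [attachLeaf, SimpleGraph.sup_adj, SimpleGraph.edge_adj, hl, and_false, false_and,
    or_false]
  exact SimpleGraph.map_adj_apply (f := Fin.castSuccEmb)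

@[simp] theorem attachLeaf_adj_castSucc_last {v : Fin n} :
    (attachLeaf G u).Adj v.castSucc (Fin.last n) ↔ v = u := by
  have hl : ∀ x : Fin n, x.castSucc ≠ Fin.last n := fun x => (Fin.castSucc_lt_last x).ne
  have hm : ¬ (G.map Fin.castSucc).Adj v.castSucc (Fin.last n) := by
    intro h
    obtain ⟨a, b, -, -, hb⟩ := (SimpleGraph.map_adj Fin.castSuccEmb G _ _).1 h
    exact hl b hb
  simp [attachLeaf, SimpleGraph.edge_adj, hl, hm]

@[simp] theorem attachLeaf_adj_last_castSucc {v : Fin n} :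
    (attachLeaf G u).Adj (Fin.last n) v.castSucc ↔ v = u := by
  rw [SimpleGraph.adj_comm, attachLeaf_adj_castSucc_last]

@[simp] theorem comap_attachLeaf : (attachLeaf G u).comap Fin.castSucc = G := by
  ext v w
  simp

theorem eq_attachLeaf {H : SimpleGraph (Fin (n + 1))}
    (hu : ∀ v : Fin n, H.Adj v.castSucc (Fin.last n) ↔ v = u) :
    H = attachLeaf (H.comap Fin.castSucc) u := by
  ext v w
  induction v using Fin.lastCases <;> induction w using Fin.lastCases <;>
    simp [hu, H.adj_comm (Fin.last n)]

end attachLeaf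

theorem isRecursiveTree_attachLeaf {N : ℕ} {G : SimpleGraph (Fin (N + 1))}
    (hG : IsRecursiveTree G) (u : Fin (N + 1)) : IsRecursiveTree (attachLeaf G u) := by
  rw [isRecursiveTree_succ_iff]
  simpa using hG

/-- The recursive trees on the vertices `0, …, N`. -/
abbrev RecTree (N : ℕ) := {G : SimpleGraph (Fin (N + 1)) // IsRecursiveTree G}

noncomputable instance (N : ℕ) : Fintype (RecTree N) := Fintype.ofFinite _

theorem attachLeaf_bijective (N : ℕ) : Function.Bijective fun x : RecTree N × Fin (N + 1) =>
    (⟨attachLeaf x.1.1 x.2, isRecursiveTree_attachLeaf x.1.2 x.2⟩ : RecTree (N + 1)) := by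
  constructor
  · rintro ⟨⟨G, hG⟩, u⟩ ⟨⟨G', hG'⟩, u'⟩ h
    have h : attachLeaf G u = attachLeaf G' u' := congrArg Subtype.val h
    have hGG : G = G' := by rw [← comap_attachLeaf G u, h, comap_attachLeaf]
    have hu : (attachLeaf G' u').Adj u.castSucc (Fin.last _) := h ▸ by simp
    subst hGG
    simpa using hu
  · rintro ⟨H, hH⟩
    obtain ⟨hG, u, hu, huu⟩ := isRecursiveTree_succ_iff.1 hH
    exact ⟨⟨⟨_, hG⟩, u⟩, Subtype.ext
      (eq_attachLeaf u fun v => ⟨huu v, fun h => h ▸ hu⟩).symm⟩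

theorem sum_recTree_succ {N : ℕ} (f : RecTree (N + 1) → ℤ) : ∑ T, f T =
    ∑ T : RecTree N, ∑ u, f ⟨attachLeaf T.1 u, isRecursiveTree_attachLeaf T.2 u⟩ := by
  rw [← (attachLeaf_bijective N).sum_comp, Fintype.sum_prod_type]

/-! ### The end of the smallest rooted path -/

theorem SmallestRootedPathEndsAt.unique {n : ℕ} {G : SimpleGraph (Fin n)} {x y : Fin n}
    (hx : SmallestRootedPathEndsAt G x) (hy : SmallestRootedPathEndsAt G y) : x = y := by
  obtain ⟨r, hr, hrx, hx⟩ := hx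
  obtain ⟨s, hs, hsy, hy⟩ := hy
  obtain rfl : r = s := Fin.ext (hr.trans hs.symm)
  rcases Relation.ReflTransGen.total_of_right_unique (fun _ _ _ h h' => h.unique h') hrx hsy
    with h | h
  · rcases h.cases_head with h | ⟨c, hc, -⟩
    · exact h
    · exact absurd hc.1 (hx c)
  · rcases h.cases_head with h | ⟨c, hc, -⟩
    · exact h.symm
    · exact absurd hc.1 (hy c)

section attachLeaf

variable {n : ℕ} {G : SimpleGraph (Fin n)} {u : Fin n}

theorem isChild_attachLeaf_castSucc {v w : Fin n} :
    IsChild (attachLeaf G u) v.castSucc w.castSucc ↔ IsChild G v w := by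
  simp [IsChild]

theorem isChild_attachLeaf_last {v : Fin n} :
    IsChild (attachLeaf G u) v.castSucc (Fin.last n) ↔ v = u := by
  simp [IsChild, Fin.castSucc_lt_last]

theorem IsSmallestChild.attachLeaf {v w : Fin n} (h : IsSmallestChild G v w) :
    IsSmallestChild (attachLeaf G u) v.castSucc w.castSucc := by
  refine ⟨isChild_attachLeaf_castSucc.2 h.1, fun x hx => ?_⟩
  induction x using Fin.lastCases with
  | last => exact Fin.le_last _
  | cast x => simpa using h.2 (isChild_attachLeaf_castSucc.1 hx)

theorem SmallestRootedPathEndsAt.attachLeaf_of_ne {x : Fin n} (h : SmallestRootedPathEndsAt G x)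
    (hx : x ≠ u) : SmallestRootedPathEndsAt (attachLeaf G u) x.castSucc := by
  obtain ⟨r, hr, hrx, he⟩ := h
  refine ⟨r.castSucc, hr, hrx.lift Fin.castSucc (fun _ _ h => h.attachLeaf), fun w hw => ?_⟩
  induction w using Fin.lastCases with
  | last => exact hx (isChild_attachLeaf_last.1 hw)
  | cast w => exact he w (isChild_attachLeaf_castSucc.1 hw)

theorem SmallestRootedPathEndsAt.attachLeaf_self (h : SmallestRootedPathEndsAt G u) :
    SmallestRootedPathEndsAt (attachLeaf G u) (Fin.last n) := by
  obtain ⟨r, hr, hrx, he⟩ := h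
  refine ⟨r.castSucc, hr, (hrx.lift Fin.castSucc (fun _ _ h => h.attachLeaf)).tail
    ⟨isChild_attachLeaf_last.2 rfl, fun w hw => ?_⟩, fun w hw => (Fin.le_last w).not_gt hw.2⟩
  induction w using Fin.lastCases with
  | last => exact le_rfl
  | cast w => exact absurd (isChild_attachLeaf_castSucc.1 hw) (he w)

end attachLeaf

theorem IsRecursiveTree.exists_end {N : ℕ} {G : SimpleGraph (Fin (N + 1))}
    (hG : IsRecursiveTree G) : ∃ x, SmallestRootedPathEndsAt G x := by
  induction N with
  | zero => exact ⟨0, 0, rfl, .refl, fun w hw => absurd hw.2 (by omega)⟩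
  | succ N ih =>
    obtain ⟨⟨⟨G', hG'⟩, u⟩, h⟩ := (attachLeaf_bijective N).2 ⟨G, hG⟩
    obtain rfl : attachLeaf G' u = G := congrArg Subtype.val h
    obtain ⟨x, hx⟩ := ih hG'
    by_cases hxu : x = u
    · subst hxu
      exact ⟨_, hx.attachLeaf_self⟩
    · exact ⟨_, hx.attachLeaf_of_ne hxu⟩

/-! ### Vertices of degree one -/

theorem degree_eq_sum {V : Type*} [Fintype V] (G : SimpleGraph V) [DecidableRel G.Adj] (v : V)
    [Fintype (G.neighborSet v)] : G.degree v = ∑ w, if G.Adj v w then 1 else 0 := by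
  rw [← Finset.card_filter, ← G.neighborFinset_eq_filter, SimpleGraph.card_neighborFinset_eq_degree]
  congr!

open Classical in
theorem degree_attachLeaf_castSucc {n : ℕ} (G : SimpleGraph (Fin n)) (u v : Fin n) :
    (attachLeaf G u).degree v.castSucc = G.degree v + if v = u then 1 else 0 := by
  rw [degree_eq_sum, degree_eq_sum, Fin.sum_univ_castSucc]
  simp

open Classical in
theorem degree_attachLeaf_last {n : ℕ} (G : SimpleGraph (Fin n)) (u : Fin n) :
    (attachLeaf G u).degree (Fin.last n) = 1 := by
  rw [degree_eq_sum, Fin.sum_univ_castSucc]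
  simp

-- The new leaf always counts; `u` stops counting if its degree rises from 1 to 2. An isolated `u`
-- would start counting, hence `hu`.
open Classical in
theorem numDegreeOne_attachLeaf {n : ℕ} (G : SimpleGraph (Fin n)) (u : Fin n)
    (hu : G.degree u ≠ 0) :
    numDegreeOne (attachLeaf G u) = numDegreeOne G + if G.degree u = 1 then 0 else 1 := by
  unfold numDegreeOne
  rw [Finset.card_filter, Finset.card_filter, Fin.sum_univ_castSucc, degree_attachLeaf_last,
    ← Finset.add_sum_erase _ _ (Finset.mem_univ u), ← Finset.add_sum_erase _ _ (Finset.mem_univ u),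
    degree_attachLeaf_castSucc]
  rw [Finset.sum_congr rfl fun v hv => by
    rw [degree_attachLeaf_castSucc, if_neg (Finset.ne_of_mem_erase hv), add_zero]]
  simp only [if_true]
  split_ifs <;> omega

open Classical in
theorem IsRecursiveTree.degree_ne_zero {N : ℕ} {G : SimpleGraph (Fin (N + 2))}
    (hG : IsRecursiveTree G) (v : Fin (N + 2)) : G.degree v ≠ 0 :=
  (hG.1.1.preconnected.degree_pos_of_nontrivial v).ne'

open Classical in
theorem IsRecursiveTree.degree_end {N : ℕ} {G : SimpleGraph (Fin (N + 2))}
    (hG : IsRecursiveTree G) {x : Fin (N + 2)} (hx : SmallestRootedPathEndsAt G x) :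
    G.degree x = 1 := by
  obtain ⟨-, -, -, he⟩ := hx
  have hlt : ∀ w, G.Adj x w → w < x := fun w hw =>
    lt_of_le_of_ne (not_lt.1 fun h => he w ⟨hw, h⟩) hw.ne'
  obtain ⟨w, hw⟩ := (G.degree_pos_iff_exists_adj x).1 (Nat.pos_of_ne_zero (hG.degree_ne_zero x))
  -- The end has no child, so any neighbour is smaller and serves as its parent.
  have hx0 : x ≠ 0 := (lt_of_le_of_lt (Fin.zero_le w) (hlt w hw)).ne'
  rw [SimpleGraph.degree_eq_one_iff_existsUnique_adj]
  exact ⟨w, hw, fun y hy => (hG.existsUnique_lt hx0).unique ⟨hy.symm, hlt y hy⟩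
    ⟨hw.symm, hlt w hw⟩⟩

/-! ### Counting recursive trees -/

/-- The number of recursive trees on `{0, …, N}` with `m + 1` vertices of degree one. -/
noncomputable def treeCount (N : ℕ) (m : ℤ) : ℤ :=
  ∑ T : RecTree N, if (numDegreeOne T.1 : ℤ) = m + 1 then 1 else 0

open Classical in
/-- The number of recursive trees on `{0, …, N}` with `m + 1` vertices of degree one whose smallest
rooted path ends at `i`. -/
noncomputable def treeEndCount (N : ℕ) (m : ℤ) (i : ℕ) : ℤ :=
  ∑ T : RecTree N, if (numDegreeOne T.1 : ℤ) = m + 1 ∧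
    ∃ v : Fin (N + 1), v.val = i ∧ SmallestRootedPathEndsAt T.1 v then 1 else 0

theorem recursiveTreeNumber_eq (N ℓ i : ℕ) :
    (recursiveTreeNumber (N + 1) ℓ i : ℤ) = treeEndCount N (ℓ - 1) i := by
  classical
  unfold recursiveTreeNumber treeEndCount
  rw [Nat.card_congr (Equiv.subtypeSubtypeEquivSubtypeInter IsRecursiveTree fun G =>
    numDegreeOne G = ℓ ∧ ∃ v : Fin (N + 1), v.val = i ∧ SmallestRootedPathEndsAt G v).symm,
    Nat.card_eq_fintype_card, Fintype.card_subtype, Finset.card_filter]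
  push_cast
  refine Finset.sum_congr rfl fun T _ => if_congr (and_congr_left fun _ => ?_) rfl rfl
  omega

theorem SmallestRootedPathEndsAt.exists_iff {n : ℕ} {G : SimpleGraph (Fin n)} {x : Fin n}
    (hx : SmallestRootedPathEndsAt G x) (i : ℕ) :
    (∃ v : Fin n, v.val = i ∧ SmallestRootedPathEndsAt G v) ↔ x.val = i := by
  constructor
  · rintro ⟨v, rfl, hv⟩
    rw [hx.unique hv]
  · exact fun h => ⟨x, h, hx⟩

open Classical in
theorem sum_numDegreeOne_add {n : ℕ} (G : SimpleGraph (Fin n)) (m : ℤ) :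
    (∑ u, if (numDegreeOne G : ℤ) + (if G.degree u = 1 then 0 else 1) = m + 1 then 1 else 0 : ℤ) =
      (m + 1) * (if (numDegreeOne G : ℤ) = m + 1 then 1 else 0) +
        (n - m) * (if (numDegreeOne G : ℤ) = m - 1 + 1 then 1 else 0) := by
  have h : ∀ u, (if (numDegreeOne G : ℤ) + (if G.degree u = 1 then 0 else 1) = m + 1 then 1 else 0 :
      ℤ) = if G.degree u = 1 then (if (numDegreeOne G : ℤ) = m + 1 then 1 else 0)
        else (if (numDegreeOne G : ℤ) = m - 1 + 1 then 1 else 0) := by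
    intro u
    split_ifs <;> omega
  have hc := Finset.card_filter_add_card_filter_not (s := Finset.univ)
    fun v : Fin n => G.degree v = 1
  rw [Finset.sum_congr rfl fun u _ => h u, Finset.sum_ite, Finset.sum_const, Finset.sum_const,
    nsmul_eq_mul, nsmul_eq_mul]
  rw [Finset.card_univ, Fintype.card_fin] at hc
  have h1 : ((Finset.univ.filter fun v : Fin n => ¬ G.degree v = 1).card : ℤ) =
    n - numDegreeOne G := by
    unfold numDegreeOne
    omega
  rw [h1]
  change (numDegreeOne G : ℤ) * _ + _ = _
  split_ifs with h2 h3 h3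
  · omega
  · rw [h2]; ring
  · rw [h3]; ring
  · ring

theorem treeCount_succ (N : ℕ) (m : ℤ) : treeCount (N + 2) m =
    (m + 1) * treeCount (N + 1) m + (N + 2 - m) * treeCount (N + 1) (m - 1) := by
  classical
  simp only [treeCount]
  rw [sum_recTree_succ, Finset.mul_sum, Finset.mul_sum, ← Finset.sum_add_distrib]
  refine Finset.sum_congr rfl fun T _ => ?_
  have := sum_numDegreeOne_add T.1 m
  push_cast at this
  simp only [numDegreeOne_attachLeaf _ _ (T.2.degree_ne_zero _), Nat.cast_add, Nat.cast_ite,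
    Nat.cast_zero, Nat.cast_one]
  linear_combination this

theorem treeEndCount_succ (N : ℕ) (m : ℤ) {i : ℕ} (hi : i ≤ N + 1) : treeEndCount (N + 2) m i =
    m * treeEndCount (N + 1) m i + (N + 2 - m) * treeEndCount (N + 1) (m - 1) i := by
  classical
  simp only [treeEndCount]
  rw [sum_recTree_succ, Finset.mul_sum, Finset.mul_sum, ← Finset.sum_add_distrib]
  refine Finset.sum_congr rfl fun T _ => ?_
  obtain ⟨x, hx⟩ := T.2.exists_end
  have hs := sum_numDegreeOne_add T.1 m
  simp only [hx.exists_iff]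
  rw [← Finset.add_sum_erase _ _ (Finset.mem_univ x)] at hs ⊢
  -- Attaching at `x` moves the end to `N + 2`, which exceeds `i`.
  rw [if_neg fun h => by
      have := (hx.attachLeaf_self.exists_iff i).1 h.2
      rw [Fin.val_last] at this
      omega, zero_add]
  have he : ∀ u ∈ Finset.univ.erase x, ((∃ v : Fin (N + 2 + 1), v.val = i ∧
      SmallestRootedPathEndsAt (attachLeaf T.1 u) v) ↔ x.val = i) := fun u hu =>
    (hx.attachLeaf_of_ne (Finset.ne_of_mem_erase hu).symm).exists_iff i
  rw [Finset.sum_congr rfl fun u hu => if_congr (and_congr_right fun _ => he u hu) rfl rfl]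
  simp only [numDegreeOne_attachLeaf _ _ (T.2.degree_ne_zero _), Nat.cast_add, Nat.cast_ite,
    Nat.cast_zero, Nat.cast_one]
  by_cases h : x.val = i
  -- The term of `x` in `hs` is what lowers the coefficient `m + 1` to `m`.
  · simp only [T.2.degree_end hx, if_true, add_zero, Nat.cast_add, Nat.cast_one] at hs
    simp only [h, and_true]
    linear_combination hs
  · simp only [h, and_false, if_false, Finset.sum_const_zero, mul_zero, add_zero]

theorem treeEndCount_last (N : ℕ) (m : ℤ) :
    treeEndCount (N + 2) m (N + 2) = treeCount (N + 1) m := by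
  classical
  rw [treeEndCount, treeCount, sum_recTree_succ]
  refine Finset.sum_congr rfl fun T _ => ?_
  obtain ⟨x, hx⟩ := T.2.exists_end
  rw [Finset.sum_eq_single x]
  · simp [hx.attachLeaf_self.exists_iff, numDegreeOne_attachLeaf _ _ (T.2.degree_ne_zero _),
      T.2.degree_end hx]
  · intro u _ hu
    refine if_neg fun h => ?_
    have := ((hx.attachLeaf_of_ne hu.symm).exists_iff _).1 h.2
    rw [Fin.val_castSucc] at this
    omega
  · simp

theorem treeCount_one (m : ℤ) : treeCount 1 m = if m = 1 then 1 else 0 := by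
  classical
  have : Unique (RecTree 0) :=
    { default := ⟨⊥, isRecursiveTree_iff.2 fun v hv => absurd (Subsingleton.elim (α := Fin 1) v 0) hv⟩
      uniq := fun T => Subtype.ext (Subsingleton.elim (α := SimpleGraph (Fin 1)) _ _) }
  have h : ∀ G : SimpleGraph (Fin 1), numDegreeOne (attachLeaf G 0) = 2 := by
    intro G
    unfold numDegreeOne
    rw [Finset.card_filter, Fin.sum_univ_castSucc, degree_attachLeaf_last, Fin.sum_univ_one,
      degree_attachLeaf_castSucc, degree_eq_sum, Fin.sum_univ_one]
    simp
  rw [treeCount, sum_recTree_succ, Fintype.sum_unique]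
  have h2 : ∀ G : SimpleGraph (Fin 1), ((numDegreeOne (attachLeaf G 0) : ℤ) = m + 1 ↔ m = 1) := by
    intro G
    rw [h]
    push_cast
    omega
  refine (Fin.sum_univ_one _).trans (if_congr (h2 _) rfl rfl)

/-! ### Comparison of the two recursions -/

theorem treeCount_eq_eulerLast (N : ℕ) (m : ℤ) : treeCount (N + 1) m = eulerLast (N + 1) m N := by
  induction N generalizing m with
  | zero =>
    rw [treeCount_one, eulerLast_succ_zero, euler_zero]
    -- The single edge, with two vertices of degree one, matches the one permutation of two letters
    -- with a descent.
    exact if_congr (by omega) rfl rfl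
  | succ N ih => rw [treeCount_succ, ih, ih, eulerLast_penultimate_rec]

theorem treeEndCount_eq_eulerLast (N : ℕ) (m : ℤ) {k : ℕ} (hk : k + 1 ≤ N) :
    treeEndCount (N + 1) m (k + 2) = eulerLast N m k := by
  induction N generalizing m with
  | zero => omega
  | succ N ih =>
    rcases Nat.lt_or_ge N (k + 1) with h | h
    · obtain rfl : k = N := by omega
      rw [treeEndCount_last, treeCount_eq_eulerLast]
    · rw [treeEndCount_succ N m (by omega), ih m h, ih (m - 1) h, eulerLast_rec N m k (by omega)]

theorem mainTheorem6 (n ℓ i : ℕ) (hi : 2 ≤ i) (hin : i ≤ n - 1) :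
    recursiveTreeNumber n ℓ i = eulerianEnding (n - 1) ((ℓ : ℤ) - 1) ((i : ℤ) - 1) := by
  obtain ⟨k, rfl⟩ := Nat.exists_eq_add_of_le' hi
  obtain ⟨N, rfl⟩ : ∃ N, n = N + 2 := ⟨n - 2, by omega⟩
  have h := eulerianEnding_eq N (ℓ - 1) k
  rw [← treeEndCount_eq_eulerLast N _ (by omega : k + 1 ≤ N), ← recursiveTreeNumber_eq] at h
  have hk : ((k + 2 : ℕ) : ℤ) - 1 = k + 1 := by push_cast; ring
  rw [hk]
  exact_mod_cast h.symm
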